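/- A two-qubit state is a positive semidefinite operator $\rho$ of trace one on $\mathbb{C}^2\otimes\mathbb{C}^2$; it is mixed if $\operatorname{rank}\rho\ge 2$. A product state in its range $R(\rho)$ is a nonzero vector of the form $a\otimes b$ in $R(\rho)$, proportional vectors being identified. We say that $R(\rho)$ is spanned by product states if it is the linear span of the product vectors that it contains. Let $\rho$ be a mixed two-qubit state. Then: (1) $R(\rho)$ is not spanned by product states if and only if $\rho$ has rank $2$ and $R(\rho)$ contains exactly one product state. In particular, if $\rho$ has rank $3$ or $4$, then $R(\rho)$ is spanned by product states. (2) $R(\rho)$ is not spanned by product states if and only if there are unitary operators $U,V$ on $\mathbb{C}^2$ such that $$(U\otimes V)\,\rho\,(U\otimes V)^\dagger=\lambda|\psi\rangle\langle\psi|+(1-\lambda)|01\rangle\langle 01|,\qquad |\psi\rangle=\sqrt{\alpha}\,|00\rangle+\sqrt{\beta}\,|11\rangle+\sqrt{\gamma}\,|01\rangle,$$ for some real numbers $0<\lambda<1$, $\alpha>0$, $\beta>0$, $\gamma\ge 0$ with $\alpha+\beta+\gamma=1$. Moreover, for all such parameters the operator $\lambda|\psi\rangle\langle\psi|+(1-\lambda)|01\rangle\langle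 01|$ is a two-qubit state of rank $2$ whose range is not spanned by product states. -/

import Mathlib

open scoped Matrix Kronecker ComplexOrder

/-- Vectors of the two-qubit space `ℂ² ⊗ ℂ²`, written in the computational basis
`|i j⟩`, indexed by `(i, j) : Fin 2 × Fin 2`. -/
abbrev QubitPairVec : Type := Fin 2 × Fin 2 → ℂ

/-- Operators on the two-qubit space, as matrices in the computational basis. -/
abbrev QubitPairMat : Type := Matrix (Fin 2 × Fin 2) (Fin 2 × Fin 2) ℂ

/-- The basis vector `|i j⟩`. -/
def ket (i j : Fin 2) : QubitPairVec := Pi.single (i, j) 1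

/-- The operator `|v⟩⟨v|`. -/
def ketbra (v : QubitPairVec) : QubitPairMat := Matrix.vecMulVec v (star v)

/-- Two-qubit states: positive semidefinite matrices of trace one. -/
def IsState (ρ : QubitPairMat) : Prop := ρ.PosSemidef ∧ ρ.trace = 1

/-- `v` represents a (pure) product state: `v` is nonzero and `v = a ⊗ b`. -/
def IsProductVec (v : QubitPairVec) : Prop :=
  v ≠ 0 ∧ ∃ a b : Fin 2 → ℂ, ∀ i j, v (i, j) = a i * b j

/-- The range (column space) of `ρ`. -/
def stateRange (ρ : QubitPairMat) : Submodule ℂ QubitPairVec := LinearMap.range ρ.mulVecLin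

/-- The range of `ρ` is spanned by the product states that it contains. -/
def RangeSpannedByProducts (ρ : QubitPairMat) : Prop :=
  Submodule.span ℂ {v | v ∈ stateRange ρ ∧ IsProductVec v} = stateRange ρ

/-- The range of `ρ` contains exactly one product state, where proportional vectors
represent the same state. -/
def RangeHasUniqueProduct (ρ : QubitPairMat) : Prop :=
  ∃ v ∈ stateRange ρ, IsProductVec v ∧
    ∀ w ∈ stateRange ρ, IsProductVec w → ∃ c : ℂ, w = c • v

/-- `√α |00⟩ + √β |11⟩ + √γ |01⟩`. -/
noncomputable def psiVec (α β γ : ℝ) : QubitPairVec :=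
  (Real.sqrt α : ℂ) • ket 0 0 + (Real.sqrt β : ℂ) • ket 1 1 + (Real.sqrt γ : ℂ) • ket 0 1

/-- `l |ψ⟩⟨ψ| + (1 - l) |01⟩⟨01|` with `ψ = √α |00⟩ + √β |11⟩ + √γ |01⟩`. -/
noncomputable def canonicalState (α β γ l : ℝ) : QubitPairMat :=
  (l : ℂ) • ketbra (psiVec α β γ) + ((1 - l : ℝ) : ℂ) • ketbra (ket 0 1)

/-- The admissible parameters of the canonical family. -/
def AdmissibleParams (α β γ l : ℝ) : Prop :=
  0 < α ∧ 0 < β ∧ 0 ≤ γ ∧ α + β + γ = 1 ∧ 0 < l ∧ l < 1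

/-! Product vectors are the nonzero isotropic vectors of a nondegenerate symmetric bilinear form,
the polarized determinant. Let `P` be the span of the isotropic vectors of a subspace `W`, with `P ≠
W`. For `w` in `W` outside `P` and `p` in `P`, no `w + t p` is isotropic, so a quadratic in `t` has
no complex root and must be constant; hence `P ⟂ W` and `dim P + dim W ≤ 4`. Solving the quadratic
along an anisotropic `w` instead gives `dim W ≤ dim P + 1`. Together `dim W ≤ 2`, and `dim W = 2`
forces `dim P = 1`: a unique product state.

For the normal form, local unitaries move that product state to `|01⟩`. Orthogonality to it and the
absence of other isotropic lines put the range in `x₁₀ = 0`, `x₁₁ = k x₀₀` with `k ≠ 0`; diagonal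
phases and a Cholesky-type splitting then yield the parameters. -/

/-! ### The determinant form and its isotropic vectors -/

/-- The polarization of the determinant form `x₀₀ x₁₁ - x₀₁ x₁₀`. -/
def detBilin : LinearMap.BilinForm ℂ QubitPairVec :=
  LinearMap.mk₂ ℂ (fun x y => x (0, 0) * y (1, 1) + x (1, 1) * y (0, 0)
      - x (0, 1) * y (1, 0) - x (1, 0) * y (0, 1))
    (fun _ _ _ => by simp only [Pi.add_apply]; ring)
    (fun _ _ _ => by simp only [Pi.smul_apply, smul_eq_mul]; ring)
    (fun _ _ _ => by simp only [Pi.add_apply]; ring)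
    (fun _ _ _ => by simp only [Pi.smul_apply, smul_eq_mul]; ring)

theorem detBilin_apply (x y : QubitPairVec) :
    detBilin x y = x (0, 0) * y (1, 1) + x (1, 1) * y (0, 0)
      - x (0, 1) * y (1, 0) - x (1, 0) * y (0, 1) := rfl

theorem detBilin_comm (x y : QubitPairVec) : detBilin x y = detBilin y x := by
  simp only [detBilin_apply]; ring

theorem eq_zero_of_detBilin (x : QubitPairVec) (h : ∀ y, detBilin x y = 0) : x = 0 := by
  have h1 := h (ket 0 0)
  have h2 := h (ket 0 1)
  have h3 := h (ket 1 0)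
  have h4 := h (ket 1 1)
  simp [detBilin_apply, ket] at h1 h2 h3 h4
  ext ⟨i, j⟩
  fin_cases i <;> fin_cases j <;> simp [*]

theorem detBilin_nondegenerate : detBilin.Nondegenerate :=
  ⟨eq_zero_of_detBilin, fun x h => eq_zero_of_detBilin x fun y => by
    rw [detBilin_comm]; exact h y⟩

theorem isProductVec_iff (w : QubitPairVec) :
    IsProductVec w ↔ w ≠ 0 ∧ detBilin w w = 0 := by
  refine and_congr_right fun _ => ⟨?_, fun h => ?_⟩
  · rintro ⟨a, b, h⟩
    simp only [detBilin_apply, h]; ring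
  · have hd : w (0, 0) * w (1, 1) = w (0, 1) * w (1, 0) := by
      rw [detBilin_apply] at h; linear_combination h / 2
    by_cases h0 : w (0, 0) = 0
    · by_cases h1 : w (0, 1) = 0
      · refine ⟨![0, 1], ![w (1, 0), w (1, 1)], fun i j => ?_⟩
        fin_cases i <;> fin_cases j <;> simp [h0, h1]
      · have h2 : w (1, 0) = 0 := by simpa [h0, h1] using hd
        refine ⟨![1, w (1, 1) / w (0, 1)], ![w (0, 0), w (0, 1)], fun i j => ?_⟩
        fin_cases i <;> fin_cases j <;> simp [h0, h1, h2]
    · refine ⟨![1, w (1, 0) / w (0, 0)], ![w (0, 0), w (0, 1)], fun i j => ?_⟩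
      fin_cases i <;> fin_cases j <;> simp [h0]
      field_simp
      linear_combination hd

theorem exists_root_of_ne_zero {a : ℂ} (ha : a ≠ 0) (b c : ℂ) :
    ∃ t : ℂ, a * (t * t) + b * t + c = 0 := by
  obtain ⟨s, hs⟩ := IsAlgClosed.exists_pow_nat_eq (discrim a b c) (n := 2) (by norm_num)
  exact exists_quadratic_eq_zero ha ⟨s, by rw [← hs, sq]⟩

theorem detBilin_add_smul (v w : QubitPairVec) (t : ℂ) :
    detBilin (v + t • w) (v + t • w)
      = detBilin w w * (t * t) + 2 * detBilin v w * t + detBilin v v := by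
  simp only [detBilin_apply, Pi.add_apply, Pi.smul_apply, smul_eq_mul]; ring

/-! ### Dimension bounds for the span of isotropic vectors -/

/-- The span of the product vectors of a subspace. -/
def productSpan (W : Submodule ℂ QubitPairVec) : Submodule ℂ QubitPairVec :=
  Submodule.span ℂ {v | v ∈ W ∧ IsProductVec v}

theorem productSpan_le (W : Submodule ℂ QubitPairVec) : productSpan W ≤ W :=
  Submodule.span_le.2 fun _ h => h.1

theorem mem_productSpan {W : Submodule ℂ QubitPairVec} {v : QubitPairVec} (hv : v ∈ W)
    (h : detBilin v v = 0) : v ∈ productSpan W := by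
  by_cases h0 : v = 0
  · rw [h0]; exact zero_mem _
  · exact Submodule.subset_span ⟨hv, (isProductVec_iff v).2 ⟨h0, h⟩⟩

theorem detBilin_eq_zero_of_notMem {W : Submodule ℂ QubitPairVec} {w p : QubitPairVec}
    (hw : w ∈ W) (hwP : w ∉ productSpan W) (hp : p ∈ productSpan W) : detBilin w p = 0 := by
  have hne : ∀ t : ℂ, detBilin (w + t • p) (w + t • p) ≠ 0 := fun t h => hwP <| by
    have := mem_productSpan (add_mem hw (W.smul_mem t (productSpan_le W hp))) h
    exact ((productSpan W).add_mem_iff_left ((productSpan W).smul_mem t hp)).1 this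
  simp only [detBilin_add_smul] at hne
  -- For isotropic `p` the polynomial in `t` is affine, so a nonzero slope would give a root;
  -- otherwise it is a true quadratic and always has one.
  by_cases hpp : detBilin p p = 0
  · by_contra hb
    refine hne (-detBilin w w / (2 * detBilin w p)) ?_
    rw [hpp]; field_simp; ring
  · obtain ⟨t, ht⟩ := exists_root_of_ne_zero hpp (2 * detBilin w p) (detBilin w w)
    exact absurd ht (hne t)

/-- An element of the product span is a difference of two elements of `W` outside it, so the
previous orthogonality extends to all of `W`. -/
theorem detBilin_eq_zero_of_productSpan_ne {W : Submodule ℂ QubitPairVec}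
    (hW : productSpan W ≠ W) {x p : QubitPairVec} (hx : x ∈ W) (hp : p ∈ productSpan W) :
    detBilin x p = 0 := by
  obtain ⟨w, hw, hwP⟩ := SetLike.exists_of_lt (lt_of_le_of_ne (productSpan_le W) hW)
  by_cases hxP : x ∈ productSpan W
  · have h1 : x + w ∉ productSpan W := fun h =>
      hwP (((productSpan W).add_mem_iff_right hxP).1 h)
    have h2 := detBilin_eq_zero_of_notMem (add_mem hx hw) h1 hp
    rw [map_add, LinearMap.add_apply, detBilin_eq_zero_of_notMem hw hwP hp] at h2
    simpa using h2
  · exact detBilin_eq_zero_of_notMem hx hxP hp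

/-- Any `w` outside the product span is anisotropic, so each line `v + t w` meets the isotropic
cone: the product span and `w` generate `W`. -/
theorem finrank_le_finrank_productSpan_add_one (W : Submodule ℂ QubitPairVec) :
    Module.finrank ℂ W ≤ Module.finrank ℂ (productSpan W) + 1 := by
  by_cases hW : productSpan W = W
  · rw [hW]; omega
  obtain ⟨w, hw, hwP⟩ := SetLike.exists_of_lt (lt_of_le_of_ne (productSpan_le W) hW)
  have hww : detBilin w w ≠ 0 := fun h => hwP (mem_productSpan hw h)
  have hle : W ≤ productSpan W ⊔ Submodule.span ℂ {w} := fun v hv => by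
    obtain ⟨t, ht⟩ := exists_root_of_ne_zero hww (2 * detBilin v w) (detBilin v v)
    rw [← detBilin_add_smul] at ht
    have h1 := mem_productSpan (add_mem hv (W.smul_mem t hw)) ht
    have h2 : v = (v + t • w) + (-t) • w := by rw [neg_smul]; abel
    rw [h2]
    exact Submodule.add_mem_sup h1
      (Submodule.smul_mem _ _ (Submodule.mem_span_singleton_self w))
  calc Module.finrank ℂ W ≤ _ := Submodule.finrank_mono hle
    _ ≤ _ := Submodule.finrank_add_le_finrank_add_finrank _ _
    _ ≤ _ := by gcongr; simpa using finrank_span_le_card (R := ℂ) ({w} : Set QubitPairVec)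

theorem finrank_productSpan_add_finrank_le {W : Submodule ℂ QubitPairVec}
    (hW : productSpan W ≠ W) :
    Module.finrank ℂ (productSpan W) + Module.finrank ℂ W ≤ 4 := by
  have h1 : productSpan W ≤ detBilin.orthogonal W := fun p hp x hx =>
    detBilin_eq_zero_of_productSpan_ne hW hx hp
  have h2 := Submodule.finrank_mono h1
  rw [LinearMap.BilinForm.finrank_orthogonal detBilin_nondegenerate] at h2
  have h3 : Module.finrank ℂ QubitPairVec = 4 := by simp
  have h4 := Submodule.finrank_le W
  omega

/-! ### Rank and uniqueness of the product state -/

theorem rangeSpannedByProducts_iff (ρ : QubitPairMat) :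
    RangeSpannedByProducts ρ ↔ productSpan (stateRange ρ) = stateRange ρ := Iff.rfl

theorem rank_eq_finrank_stateRange (ρ : QubitPairMat) :
    ρ.rank = Module.finrank ℂ (stateRange ρ) := rfl

theorem rank_le_two_of_not_spanned {ρ : QubitPairMat} (h : ¬ RangeSpannedByProducts ρ) :
    ρ.rank ≤ 2 := by
  rw [rangeSpannedByProducts_iff] at h
  have h1 := finrank_productSpan_add_finrank_le h
  have h2 := finrank_le_finrank_productSpan_add_one (stateRange ρ)
  rw [rank_eq_finrank_stateRange]; omega

theorem rangeHasUniqueProduct_of_not_spanned {ρ : QubitPairMat} (hr : 2 ≤ ρ.rank)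
    (h : ¬ RangeSpannedByProducts ρ) : RangeHasUniqueProduct ρ := by
  rw [rangeSpannedByProducts_iff] at h
  have h1 := finrank_productSpan_add_finrank_le h
  have h2 := finrank_le_finrank_productSpan_add_one (stateRange ρ)
  rw [rank_eq_finrank_stateRange] at hr
  have h4 := Submodule.finrank_lt_finrank_of_lt (lt_of_le_of_ne (productSpan_le _) h)
  have h3 : Module.finrank ℂ (productSpan (stateRange ρ)) = 1 := by omega
  obtain ⟨v, hv, hvp⟩ : ∃ v, v ∈ stateRange ρ ∧ IsProductVec v := by
    by_contra! hne
    have : productSpan (stateRange ρ) = ⊥ := by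
      refine Submodule.span_eq_bot.2 fun x hx => absurd hx.2 (hne x hx.1)
    rw [this] at h3; simp at h3
  refine ⟨v, hv, hvp, fun w hw hwp => ?_⟩
  have hv0 : (⟨v, Submodule.subset_span ⟨hv, hvp⟩⟩ : productSpan (stateRange ρ)) ≠ 0 :=
    fun h => hvp.1 (congrArg Subtype.val h)
  obtain ⟨c, hc⟩ := (finrank_eq_one_iff_of_nonzero' _ hv0).1 h3
    ⟨w, Submodule.subset_span ⟨hw, hwp⟩⟩
  exact ⟨c, (congrArg Subtype.val hc).symm⟩

theorem RangeHasUniqueProduct.not_spanned {ρ : QubitPairMat} (hr : 2 ≤ ρ.rank)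
    (h : RangeHasUniqueProduct ρ) : ¬ RangeSpannedByProducts ρ := by
  obtain ⟨v, -, -, hu⟩ := h
  intro hs
  rw [RangeSpannedByProducts] at hs
  have hle : stateRange ρ ≤ Submodule.span ℂ {v} := by
    rw [← hs]
    refine Submodule.span_le.2 fun w hw => ?_
    obtain ⟨c, rfl⟩ := hu w hw.1 hw.2
    exact Submodule.smul_mem _ _ (Submodule.mem_span_singleton_self v)
  have h1 := Submodule.finrank_mono hle
  have h2 : Module.finrank ℂ (Submodule.span ℂ {v}) ≤ 1 := by
    simpa using finrank_span_le_card (R := ℂ) ({v} : Set QubitPairVec)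
  rw [rank_eq_finrank_stateRange] at hr
  omega

/-! ### Invariance under local unitaries -/

theorem kronecker_mulVec_product (U V : Matrix (Fin 2) (Fin 2) ℂ) (a b : Fin 2 → ℂ)
    (v : QubitPairVec) (hv : ∀ i j, v (i, j) = a i * b j) (i j : Fin 2) :
    ((U ⊗ₖ V) *ᵥ v) (i, j) = (U *ᵥ a) i * (V *ᵥ b) j := by
  simp only [Matrix.mulVec, dotProduct, Fintype.sum_prod_type, Fin.sum_univ_two,
    Matrix.kroneckerMap_apply, hv]
  ring

theorem conjTranspose_mul_self_of_mem_unitary {n : Type*} [Fintype n] [DecidableEq n]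
    {M : Matrix n n ℂ} (hM : M ∈ Matrix.unitaryGroup n ℂ) : Mᴴ * M = 1 :=
  Matrix.mem_unitaryGroup_iff'.1 hM

theorem stateRange_conj {M : QubitPairMat} (hM : M ∈ Matrix.unitaryGroup _ ℂ)
    (ρ : QubitPairMat) :
    stateRange (M * ρ * Mᴴ) = (stateRange ρ).map M.mulVecLin := by
  have hM' := conjTranspose_mul_self_of_mem_unitary hM
  ext v
  simp only [stateRange, Submodule.mem_map, LinearMap.mem_range, Matrix.mulVecLin_apply]
  constructor
  · rintro ⟨x, rfl⟩
    exact ⟨_, ⟨Mᴴ *ᵥ x, rfl⟩, by simp [Matrix.mulVec_mulVec, Matrix.mul_assoc]⟩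
  · rintro ⟨_, ⟨x, rfl⟩, rfl⟩
    exact ⟨M *ᵥ x, by simp [Matrix.mulVec_mulVec, Matrix.mul_assoc, hM']⟩

theorem kronecker_mem_unitaryGroup {U V : Matrix (Fin 2) (Fin 2) ℂ}
    (hU : U ∈ Matrix.unitaryGroup (Fin 2) ℂ) (hV : V ∈ Matrix.unitaryGroup (Fin 2) ℂ) :
    U ⊗ₖ V ∈ Matrix.unitaryGroup (Fin 2 × Fin 2) ℂ :=
  Matrix.kronecker_mem_unitary hU hV

theorem IsProductVec.kronecker_mulVec {U V : Matrix (Fin 2) (Fin 2) ℂ}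
    (hU : U ∈ Matrix.unitaryGroup (Fin 2) ℂ) (hV : V ∈ Matrix.unitaryGroup (Fin 2) ℂ)
    {v : QubitPairVec} (hv : IsProductVec v) : IsProductVec ((U ⊗ₖ V) *ᵥ v) := by
  obtain ⟨h0, a, b, hab⟩ := hv
  refine ⟨fun h => h0 ?_, U *ᵥ a, V *ᵥ b, kronecker_mulVec_product U V a b v hab⟩
  have hM := conjTranspose_mul_self_of_mem_unitary (kronecker_mem_unitaryGroup hU hV)
  simpa [Matrix.mulVec_mulVec, hM] using congrArg ((U ⊗ₖ V)ᴴ *ᵥ ·) h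

theorem RangeSpannedByProducts.conj {U V : Matrix (Fin 2) (Fin 2) ℂ}
    (hU : U ∈ Matrix.unitaryGroup (Fin 2) ℂ) (hV : V ∈ Matrix.unitaryGroup (Fin 2) ℂ)
    {ρ : QubitPairMat} (h : RangeSpannedByProducts ρ) :
    RangeSpannedByProducts ((U ⊗ₖ V) * ρ * (U ⊗ₖ V)ᴴ) := by
  refine le_antisymm (productSpan_le _) ?_
  rw [RangeSpannedByProducts] at h
  rw [stateRange_conj (kronecker_mem_unitaryGroup hU hV)]
  conv_lhs => rw [← h, Submodule.map_span]
  refine Submodule.span_mono ?_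
  rintro _ ⟨v, ⟨hv, hvp⟩, rfl⟩
  exact ⟨Submodule.mem_map_of_mem hv, hvp.kronecker_mulVec hU hV⟩

theorem rangeSpannedByProducts_conj_iff {U V : Matrix (Fin 2) (Fin 2) ℂ}
    (hU : U ∈ Matrix.unitaryGroup (Fin 2) ℂ) (hV : V ∈ Matrix.unitaryGroup (Fin 2) ℂ)
    {ρ : QubitPairMat} :
    RangeSpannedByProducts ((U ⊗ₖ V) * ρ * (U ⊗ₖ V)ᴴ) ↔ RangeSpannedByProducts ρ := by
  refine ⟨fun h => ?_, fun h => h.conj hU hV⟩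
  have hM := conjTranspose_mul_self_of_mem_unitary (kronecker_mem_unitaryGroup hU hV)
  have h1 := h.conj (Unitary.star_mem hU) (Unitary.star_mem hV)
  rw [Matrix.star_eq_conjTranspose, Matrix.star_eq_conjTranspose,
    ← Matrix.conjTranspose_kronecker, Matrix.conjTranspose_conjTranspose] at h1
  have h2 : (U ⊗ₖ V)ᴴ * ((U ⊗ₖ V) * ρ * (U ⊗ₖ V)ᴴ) * (U ⊗ₖ V) = ρ := by
    calc _ = ((U ⊗ₖ V)ᴴ * (U ⊗ₖ V)) * ρ * ((U ⊗ₖ V)ᴴ * (U ⊗ₖ V)) := by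
          simp only [Matrix.mul_assoc]
      _ = ρ := by rw [hM, Matrix.one_mul, Matrix.mul_one]
  rwa [h2] at h1

/-! ### The canonical family -/

theorem canonicalState_mulVec (α β γ l : ℝ) (x : QubitPairVec) :
    canonicalState α β γ l *ᵥ x
      = (l * (star (psiVec α β γ) ⬝ᵥ x)) • psiVec α β γ + ((1 - l) * x (0, 1)) • ket 0 1 := by
  have h : star (ket 0 1) ⬝ᵥ x = x (0, 1) := by
    simp [ket, dotProduct, Pi.single_apply]
  simp only [canonicalState, ketbra, Matrix.add_mulVec, Matrix.smul_mulVec,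
    Matrix.vecMulVec_mulVec, op_smul_eq_smul, smul_smul, h]
  push_cast
  rfl

theorem isState_canonicalState {α β γ l : ℝ} (h : AdmissibleParams α β γ l) :
    IsState (canonicalState α β γ l) := by
  obtain ⟨hα, hβ, hγ, hs, hl, hl1⟩ := h
  constructor
  · refine Matrix.PosSemidef.add ?_ ?_
    · exact (Matrix.posSemidef_vecMulVec_self_star _).smul (by exact_mod_cast hl.le)
    · exact (Matrix.posSemidef_vecMulVec_self_star _).smul
        (by exact_mod_cast (sub_pos.2 hl1).le)
  · have e : ∀ r : ℝ, 0 ≤ r → (Real.sqrt r : ℂ) * (Real.sqrt r : ℂ) = r := fun r hr => by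
      rw [← Complex.ofReal_mul, Real.mul_self_sqrt hr]
    have hs' : (α + β + γ : ℂ) = 1 := by exact_mod_cast hs
    simp [canonicalState, ketbra, Matrix.trace, Fintype.sum_prod_type, Matrix.vecMulVec_apply,
      psiVec, ket, Pi.single_apply, e α hα.le, e β hβ.le, e γ hγ]
    linear_combination (l : ℂ) * hs'

theorem psiVec_mem_stateRange {α β γ l : ℝ} (h : AdmissibleParams α β γ l) :
    psiVec α β γ ∈ stateRange (canonicalState α β γ l) := by
  obtain ⟨hα, hβ, hγ, hs, hl, hl1⟩ := h
  have h1 : star (psiVec α β γ) ⬝ᵥ ket 0 0 = Real.sqrt α := by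
    simp [psiVec, ket, dotProduct, Pi.single_apply]
  have h2 : canonicalState α β γ l *ᵥ ket 0 0 = ((l : ℂ) * Real.sqrt α) • psiVec α β γ := by
    rw [canonicalState_mulVec, h1]; simp [ket]
  have hα' : (Real.sqrt α : ℂ) ≠ 0 := by exact_mod_cast (Real.sqrt_pos.2 hα).ne'
  have hl' : (l : ℂ) ≠ 0 := by exact_mod_cast hl.ne'
  refine ((stateRange _).smul_mem_iff (mul_ne_zero hl' hα')).1 ?_
  rw [← h2]
  exact ⟨_, rfl⟩

theorem ket_mem_stateRange {α β γ l : ℝ} (h : AdmissibleParams α β γ l) :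
    ket 0 1 ∈ stateRange (canonicalState α β γ l) := by
  have h2 := canonicalState_mulVec α β γ l (ket 0 1)
  have h3 : canonicalState α β γ l *ᵥ ket 0 1 ∈ stateRange (canonicalState α β γ l) := ⟨_, rfl⟩
  rw [h2, (stateRange _).add_mem_iff_right
    ((stateRange _).smul_mem _ (psiVec_mem_stateRange h))] at h3
  refine ((stateRange _).smul_mem_iff ?_).1 h3
  obtain ⟨hα, hβ, hγ, hs, hl, hl1⟩ := h
  have : ((1 - l : ℝ) : ℂ) ≠ 0 := by exact_mod_cast (sub_pos.2 hl1).ne'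
  simpa [ket] using this

theorem not_spanned_canonicalState {α β γ l : ℝ} (h : AdmissibleParams α β γ l) :
    ¬ RangeSpannedByProducts (canonicalState α β γ l) := by
  intro hs
  have hψ := psiVec_mem_stateRange h
  obtain ⟨hα, hβ, hγ, hsum, hl, hl1⟩ := h
  have hα' : (Real.sqrt α : ℂ) ≠ 0 := by exact_mod_cast (Real.sqrt_pos.2 hα).ne'
  have hβ' : (Real.sqrt β : ℂ) ≠ 0 := by exact_mod_cast (Real.sqrt_pos.2 hβ).ne'
  rw [RangeSpannedByProducts] at hs
  -- On `y ψ + z |01⟩` the form equals `2 √α √β y²`, so isotropic vectors have `y = 0` and vanish at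
  -- `(0, 0)`, unlike `ψ`.
  have hle : stateRange (canonicalState α β γ l)
      ≤ LinearMap.ker (LinearMap.proj (R := ℂ) (φ := fun _ : Fin 2 × Fin 2 => ℂ) (0, 0)) := by
    conv_lhs => rw [← hs]
    refine Submodule.span_le.2 ?_
    rintro w ⟨⟨x, rfl⟩, hw⟩
    have h1 := ((isProductVec_iff _).1 hw).2
    rw [Matrix.mulVecLin_apply, canonicalState_mulVec] at h1
    rw [SetLike.mem_coe, LinearMap.mem_ker, Matrix.mulVecLin_apply, canonicalState_mulVec]
    set y : ℂ := (l : ℂ) * (star (psiVec α β γ) ⬝ᵥ x)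
    simp [detBilin_apply, psiVec, ket] at h1
    have h2 : y = 0 := by
      have h3 : 2 * (Real.sqrt α * Real.sqrt β) * (y * y) = 0 := by linear_combination h1
      simpa [hα', hβ'] using h3
    rw [h2]
    simp [ket]
  have := hle hψ
  simp [psiVec, ket] at this
  exact hα' (by simpa using this)

theorem rank_canonicalState {α β γ l : ℝ} (h : AdmissibleParams α β γ l) :
    (canonicalState α β γ l).rank = 2 := by
  refine le_antisymm (rank_le_two_of_not_spanned (not_spanned_canonicalState h)) ?_
  have hα' : (Real.sqrt α : ℂ) ≠ 0 := by exact_mod_cast (Real.sqrt_pos.2 h.1).ne'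
  have hli : LinearIndependent ℂ ![psiVec α β γ, ket 0 1] := by
    refine LinearIndependent.pair_iff.2 fun s t hst => ?_
    have h0 := congrFun hst (0, 0)
    have h1 := congrFun hst (0, 1)
    simp [psiVec, ket] at h0 h1
    have hs : s = 0 := h0.resolve_right (by simpa using hα')
    exact ⟨hs, by simpa [hs] using h1⟩
  have h2 := finrank_span_eq_card hli
  rw [rank_eq_finrank_stateRange]
  refine (h2.trans (Fintype.card_fin 2)).ge.trans (Submodule.finrank_mono (Submodule.span_le.2 ?_))
  rintro _ ⟨i, rfl⟩
  fin_cases i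
  · exact psiVec_mem_stateRange h
  · exact ket_mem_stateRange h

/-! ### Unitaries and phases for the normalization -/

theorem exists_unitary_mulVec_apply_eq_zero {a : Fin 2 → ℂ} (ha : a ≠ 0) (i : Fin 2) :
    ∃ U ∈ Matrix.unitaryGroup (Fin 2) ℂ, (U *ᵥ a) i = 0 := by
  set s : ℝ := Complex.normSq (a 0) + Complex.normSq (a 1) with hs
  have hs0 : 0 < s := by
    have h0 := Complex.normSq_nonneg (a 0)
    have h1 := Complex.normSq_nonneg (a 1)
    refine lt_of_le_of_ne (by positivity) fun h => ha ?_
    ext j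
    fin_cases j
    · exact Complex.normSq_eq_zero.1 (show Complex.normSq (a 0) = 0 by linarith)
    · exact Complex.normSq_eq_zero.1 (show Complex.normSq (a 1) = 0 by linarith)
  have hr0 : (Real.sqrt s : ℂ) ≠ 0 := by exact_mod_cast (Real.sqrt_pos.2 hs0).ne'
  have hrr : (Real.sqrt s : ℂ) * Real.sqrt s
      = a 0 * (starRingEnd ℂ) (a 0) + a 1 * (starRingEnd ℂ) (a 1) := by
    rw [← Complex.ofReal_mul, Real.mul_self_sqrt hs0.le, hs, Complex.mul_conj, Complex.mul_conj]
    push_cast; rfl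
  set r : ℂ := (Real.sqrt s : ℂ) with hr
  have hrc : (starRingEnd ℂ) r = r := Complex.conj_ofReal _
  fin_cases i
  · refine ⟨!![-a 1 / r, a 0 / r; star (a 0) / r, star (a 1) / r], ?_, ?_⟩
    · rw [Matrix.mem_unitaryGroup_iff]
      ext i j
      fin_cases i <;> fin_cases j <;>
        simp [Matrix.mul_apply, Fin.sum_univ_two, Matrix.star_apply, hrc] <;>
        field_simp <;> first | linear_combination (-1 : ℂ) * hrr | ring
    · simp [Matrix.mulVec, dotProduct, Fin.sum_univ_two]; ring
  · refine ⟨!![star (a 0) / r, star (a 1) / r; -a 1 / r, a 0 / r], ?_, ?_⟩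
    · rw [Matrix.mem_unitaryGroup_iff]
      ext i j
      fin_cases i <;> fin_cases j <;>
        simp [Matrix.mul_apply, Fin.sum_univ_two, Matrix.star_apply, hrc] <;>
        field_simp <;> first | linear_combination (-1 : ℂ) * hrr | ring
    · simp [Matrix.mulVec, dotProduct, Fin.sum_univ_two]; ring

theorem exists_kronecker_mulVec_eq_ket {v : QubitPairVec} (hv : IsProductVec v) :
    ∃ U ∈ Matrix.unitaryGroup (Fin 2) ℂ, ∃ V ∈ Matrix.unitaryGroup (Fin 2) ℂ,
      ∃ c : ℂ, c ≠ 0 ∧ (U ⊗ₖ V) *ᵥ v = c • ket 0 1 := by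
  obtain ⟨h0, a, b, hab⟩ := id hv
  have ha : a ≠ 0 := by
    rintro rfl
    exact h0 (funext fun ⟨i, j⟩ => by simp [hab])
  have hb : b ≠ 0 := by
    rintro rfl
    exact h0 (funext fun ⟨i, j⟩ => by simp [hab])
  obtain ⟨U, hU, hUa⟩ := exists_unitary_mulVec_apply_eq_zero ha 1
  obtain ⟨V, hV, hVb⟩ := exists_unitary_mulVec_apply_eq_zero hb 0
  have hUV := kronecker_mulVec_product U V a b v hab
  have he : (U ⊗ₖ V) *ᵥ v = ((U *ᵥ a) 0 * (V *ᵥ b) 1) • ket 0 1 := by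
    ext ⟨i, j⟩
    rw [hUV]
    fin_cases i <;> fin_cases j <;> simp [ket, hUa, hVb]
  refine ⟨U, hU, V, hV, _, fun hc => ?_, he⟩
  rw [hc, zero_smul] at he
  exact (hv.kronecker_mulVec hU hV).1 he

theorem exists_unit_mul_eq_norm (z : ℂ) :
    ∃ u : ℂ, u * (starRingEnd ℂ) u = 1 ∧ u * z = (‖z‖ : ℂ) := by
  by_cases hz : z = 0
  · exact ⟨1, by simp, by simp [hz]⟩
  have hn : (‖z‖ : ℂ) ≠ 0 := by exact_mod_cast norm_ne_zero_iff.2 hz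
  refine ⟨(starRingEnd ℂ) z / ‖z‖, ?_, ?_⟩
  · have := Complex.mul_conj' z
    simp only [map_div₀, Complex.conj_conj, Complex.conj_ofReal]
    field_simp
    linear_combination this
  · have := Complex.conj_mul' z
    field_simp
    linear_combination this

/-! ### Reduction to the canonical family -/

/-- The vector `p |00⟩ + q |01⟩ + s |11⟩`. -/
def upperVec (p q s : ℂ) : QubitPairVec := p • ket 0 0 + q • ket 0 1 + s • ket 1 1

/-- Taking squares as parameters removes the square roots, and the weight `N ^ 2` absorbs the
normalization of `ψ`. -/
theorem canonicalState_apply_of_sq {p q s N : ℝ} (hp : 0 ≤ p) (hq : 0 ≤ q) (hs : 0 ≤ s)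
    (hN : 0 < N) (x y : Fin 2 × Fin 2) :
    canonicalState ((p / N) ^ 2) ((s / N) ^ 2) ((q / N) ^ 2) (N ^ 2) x y
      = upperVec p q s x * upperVec p q s y + (1 - N ^ 2) * (ket 0 1 x * ket 0 1 y) := by
  have hN' : (N : ℂ) ≠ 0 := by exact_mod_cast hN.ne'
  have hψ : psiVec ((p / N) ^ 2) ((s / N) ^ 2) ((q / N) ^ 2)
      = (N : ℂ)⁻¹ • upperVec p q s := by
    rw [psiVec, Real.sqrt_sq (by positivity), Real.sqrt_sq (by positivity),
      Real.sqrt_sq (by positivity), upperVec]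
    ext x
    simp only [Pi.add_apply, Pi.smul_apply, smul_eq_mul]
    push_cast
    ring
  have hket : ∀ i j, (starRingEnd ℂ) (ket i j y) = ket i j y := fun i j => by
    simp only [ket, Pi.single_apply]; split_ifs <;> simp
  have hstar : (starRingEnd ℂ) (upperVec p q s y) = upperVec p q s y := by
    simp [upperVec, hket]
  simp only [canonicalState, ketbra, hψ, Matrix.add_apply, Matrix.smul_apply,
    Matrix.vecMulVec_apply, Pi.smul_apply, Pi.star_apply, smul_eq_mul, star_mul',
    Complex.star_def, hstar, hket, map_inv₀, Complex.conj_ofReal]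
  push_cast
  field_simp

theorem exists_canonicalState_of_entries {σ : QubitPairMat} (hσ : IsState σ) {k : ℂ}
    (hk : k ≠ 0) (h10 : ∀ x, σ (1, 0) x = 0) (h11 : ∀ x, σ (1, 1) x = k * σ (0, 0) x)
    (ha0 : σ (0, 0) (0, 0) ≠ 0)
    (hdet : σ (0, 0) (0, 0) * σ (0, 1) (0, 1) ≠ σ (0, 0) (0, 1) * σ (0, 1) (0, 0)) :
    ∃ U ∈ Matrix.unitaryGroup (Fin 2) ℂ, ∃ V ∈ Matrix.unitaryGroup (Fin 2) ℂ,
      ∃ α β γ l : ℝ, AdmissibleParams α β γ l ∧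
        (U ⊗ₖ V) * σ * (U ⊗ₖ V)ᴴ = canonicalState α β γ l := by
  obtain ⟨hpsd, htr⟩ := hσ
  have hH : ∀ x y, σ x y = (starRingEnd ℂ) (σ y x) := fun x y => (hpsd.1.apply x y).symm
  have hdiag : ∀ x, 0 ≤ σ x x := fun x => hpsd.diag_nonneg
  obtain ⟨a, ha⟩ : ∃ a : ℝ, σ (0, 0) (0, 0) = a :=
    ⟨_, (Complex.conj_eq_iff_re.1 (hH _ _).symm).symm⟩
  obtain ⟨d, hd⟩ : ∃ d : ℝ, σ (0, 1) (0, 1) = d :=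
    ⟨_, (Complex.conj_eq_iff_re.1 (hH _ _).symm).symm⟩
  obtain ⟨B, hB⟩ : ∃ B : ℂ, σ (0, 0) (0, 1) = B := ⟨_, rfl⟩
  have hB' : σ (0, 1) (0, 0) = (starRingEnd ℂ) B := by rw [hH, hB]
  have h10' : ∀ x, σ x (1, 0) = 0 := fun x => by rw [hH, h10, map_zero]
  have h11' : ∀ x, σ x (1, 1) = (starRingEnd ℂ) k * σ x (0, 0) := fun x => by
    rw [hH, h11, map_mul, ← hH]
  have hapos : 0 < a := by
    have h1 := hdiag (0, 0)
    rw [ha] at h1 ha0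
    exact lt_of_le_of_ne (by exact_mod_cast h1) fun h => ha0 (by rw [← h]; simp)
  have hdetpos : ‖B‖ ^ 2 < a * d := by
    have h1 := (hpsd.submatrix ![((0 : Fin 2), (0 : Fin 2)), (0, 1)]).det_nonneg
    rw [Matrix.det_fin_two] at h1
    simp only [Matrix.submatrix_apply, Matrix.cons_val_zero, Matrix.cons_val_one] at h1
    rw [ha, hd, hB, hB', Complex.mul_conj'] at h1
    rw [ha, hd, hB, hB', Complex.mul_conj'] at hdet
    have h2 : ‖B‖ ^ 2 ≤ a * d := by
      have : (0 : ℂ) ≤ ((a * d - ‖B‖ ^ 2 : ℝ) : ℂ) := by push_cast; exact h1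
      have := Complex.zero_le_real.1 this
      linarith
    refine lt_of_le_of_ne h2 fun h => hdet ?_
    exact_mod_cast h.symm
  have htr' : a + ‖k‖ ^ 2 * a + d = 1 := by
    simp only [Matrix.trace, Matrix.diag_apply, Fintype.sum_prod_type, Fin.sum_univ_two] at htr
    rw [h10, h11, h11', ha, hd] at htr
    have h1 := Complex.mul_conj' k
    have : ((a + ‖k‖ ^ 2 * a + d : ℝ) : ℂ) = 1 := by
      push_cast
      linear_combination htr - (a : ℂ) * h1
    exact_mod_cast this
  obtain ⟨v, hv1, hvB⟩ := exists_unit_mul_eq_norm B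
  obtain ⟨e, he1, hek⟩ := exists_unit_mul_eq_norm k
  have hkpos : 0 < ‖k‖ := norm_pos_iff.2 hk
  -- Cholesky-type splitting: `p`, `q`, `s` reproduce the row of `|00⟩` up to phases, and `d - q ^
  -- 2`, positive by the strict minor, is the remaining weight on `|01⟩`.
  set p := Real.sqrt a with hp
  have hpp : p * p = a := Real.mul_self_sqrt hapos.le
  have hppos : 0 < p := Real.sqrt_pos.2 hapos
  set q := ‖B‖ / p with hq
  have hpq : p * q = ‖B‖ := by rw [hq]; field_simp
  have hqnn : 0 ≤ q := by positivity
  set s := ‖k‖ * p with hs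
  have hspos : 0 < s := by positivity
  set N := Real.sqrt (p ^ 2 + s ^ 2 + q ^ 2) with hN
  have hNN : N ^ 2 = p ^ 2 + s ^ 2 + q ^ 2 := Real.sq_sqrt (by positivity)
  have hNpos : 0 < N := Real.sqrt_pos.2 (by positivity)
  have hqd : q ^ 2 < d := by
    rw [hq, div_pow, div_lt_iff₀ (by positivity), sq p, hpp]; linarith
  have hN1 : 1 - N ^ 2 = d - q ^ 2 := by
    rw [hNN, hs]; linear_combination (-1 - ‖k‖ ^ 2) * hpp - htr'
  -- The phases on `|00⟩`, `|01⟩`, `|11⟩` are `v`, `1`, `v * e`, which turn `B` into `‖B‖` and `k`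
  -- into `‖k‖`.
  refine ⟨Matrix.diagonal ![1, v * e], ?_, Matrix.diagonal ![v, 1], ?_,
    (p / N) ^ 2, (s / N) ^ 2, (q / N) ^ 2, N ^ 2,
    ⟨by positivity, by positivity, by positivity, ?_, by positivity, by linarith⟩, ?_⟩
  · rw [Matrix.mem_unitaryGroup_iff, Matrix.star_eq_conjTranspose,
      Matrix.diagonal_conjTranspose, Matrix.diagonal_mul_diagonal, ← Matrix.diagonal_one]
    congr 1
    ext i
    fin_cases i
    · simp
    · simp
      linear_combination e * (starRingEnd ℂ) e * hv1 + he1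
  · rw [Matrix.mem_unitaryGroup_iff, Matrix.star_eq_conjTranspose,
      Matrix.diagonal_conjTranspose, Matrix.diagonal_mul_diagonal, ← Matrix.diagonal_one]
    congr 1
    ext i
    fin_cases i
    · simpa using hv1
    · simp
  · field_simp
    linarith
  · have cpp : (p : ℂ) * p = a := by exact_mod_cast hpp
    have cpq : (p : ℂ) * q = ‖B‖ := by exact_mod_cast hpq
    have cs : (s : ℂ) = ‖k‖ * p := by exact_mod_cast hs
    have cN : (1 - (N : ℂ) ^ 2) = d - q ^ 2 := by exact_mod_cast hN1
    have hek' : (starRingEnd ℂ) e * (starRingEnd ℂ) k = ‖k‖ := by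
      rw [← map_mul, hek, Complex.conj_ofReal]
    have hvB' : (starRingEnd ℂ) v * (starRingEnd ℂ) B = ‖B‖ := by
      rw [← map_mul, hvB, Complex.conj_ofReal]
    rw [Matrix.diagonal_kronecker_diagonal, Matrix.diagonal_conjTranspose]
    ext ⟨i, j⟩ ⟨i', j'⟩
    rw [canonicalState_apply_of_sq hppos.le hqnn hspos.le hNpos, cN,
      Matrix.mul_diagonal, Matrix.diagonal_mul]
    fin_cases i <;> fin_cases j <;> fin_cases i' <;> fin_cases j' <;>
      simp [upperVec, ket, h10, h10', h11, h11', ha, hd, hB, hB', cs]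
    · linear_combination (a : ℂ) * hv1 - cpp
    · linear_combination hvB - cpq
    · linear_combination a * (starRingEnd ℂ) e * (starRingEnd ℂ) k * hv1 + a * hek' - ‖k‖ * cpp
    · linear_combination hvB' - cpq
    · ring
    · linear_combination (starRingEnd ℂ) k * (starRingEnd ℂ) e * hvB' + ‖B‖ * hek' - ‖k‖ * cpq
    · linear_combination a * e * k * hv1 + a * hek - ‖k‖ * cpp
    · linear_combination e * k * hvB + ‖B‖ * hek - ‖k‖ * cpq
    · linear_combination a * e * k * (starRingEnd ℂ) e * (starRingEnd ℂ) k * hv1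
        + a * (starRingEnd ℂ) e * (starRingEnd ℂ) k * hek + a * ‖k‖ * hek' - ‖k‖ ^ 2 * cpp

theorem mulVec_mem_stateRange (σ : QubitPairMat) (x : QubitPairVec) :
    σ *ᵥ x ∈ stateRange σ := ⟨x, rfl⟩

theorem exists_canonicalState_of_ket_mem {σ : QubitPairMat} (hσ : IsState σ)
    (hns : ¬ RangeSpannedByProducts σ) (hket : ket 0 1 ∈ stateRange σ) :
    ∃ U ∈ Matrix.unitaryGroup (Fin 2) ℂ, ∃ V ∈ Matrix.unitaryGroup (Fin 2) ℂ,
      ∃ α β γ l : ℝ, AdmissibleParams α β γ l ∧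
        (U ⊗ₖ V) * σ * (U ⊗ₖ V)ᴴ = canonicalState α β γ l := by
  rw [rangeSpannedByProducts_iff] at hns
  have hH : ∀ x y, σ x y = (starRingEnd ℂ) (σ y x) := fun x y => (hσ.1.1.apply x y).symm
  have hketP : ket 0 1 ∈ productSpan (stateRange σ) :=
    mem_productSpan hket (by simp [detBilin_apply, ket])
  have h10 : ∀ x ∈ stateRange σ, x (1, 0) = 0 := fun x hx => by
    simpa [detBilin_apply, ket] using detBilin_eq_zero_of_productSpan_ne hns hx hketP
  obtain ⟨w, hw, hwP⟩ := SetLike.exists_of_lt (lt_of_le_of_ne (productSpan_le _) hns)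
  have hww : w (0, 0) * w (1, 1) ≠ 0 := fun h => hwP <| mem_productSpan hw <| by
    rw [detBilin_apply, h10 w hw]; linear_combination 2 * h
  have hw0 := left_ne_zero_of_mul hww
  have hw1 := right_ne_zero_of_mul hww
  have h11 : ∀ x ∈ stateRange σ, x (1, 1) = w (1, 1) / w (0, 0) * x (0, 0) := fun x hx => by
    -- This combination vanishes at `(0, 0)` and `(1, 0)`, hence is isotropic and so orthogonal to
    -- `w`.
    have hy : w (0, 0) • x - x (0, 0) • w ∈ stateRange σ :=
      sub_mem (Submodule.smul_mem _ _ hx) (Submodule.smul_mem _ _ hw)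
    have hyP := mem_productSpan hy (by
      simp only [detBilin_apply, Pi.sub_apply, Pi.smul_apply, smul_eq_mul, h10 x hx, h10 w hw]
      ring)
    have h := detBilin_eq_zero_of_productSpan_ne hns hw hyP
    simp only [detBilin_apply, Pi.sub_apply, Pi.smul_apply, smul_eq_mul, h10 x hx,
      h10 w hw] at h
    have h' : w (0, 0) * (w (0, 0) * x (1, 1) - x (0, 0) * w (1, 1)) = 0 := by
      linear_combination h
    have h'' := (mul_eq_zero.1 h').resolve_left hw0
    field_simp
    linear_combination h''
  have hcol : ∀ y, (fun x => σ x y) ∈ stateRange σ := fun y => by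
    have := mulVec_mem_stateRange σ (Pi.single y 1)
    rwa [Matrix.mulVec_single_one] at this
  have h10' : ∀ x, σ x (1, 0) = 0 := fun x => by rw [hH, h10 _ (hcol x), map_zero]
  have h11' : ∀ x, σ x (1, 1) = (starRingEnd ℂ) (w (1, 1) / w (0, 0)) * σ x (0, 0) :=
    fun x => by rw [hH, h11 _ (hcol x), map_mul, ← hH]
  have hrow : ∀ i x, (σ *ᵥ x) i = σ i (0, 0) * (x (0, 0)
      + (starRingEnd ℂ) (w (1, 1) / w (0, 0)) * x (1, 1)) + σ i (0, 1) * x (0, 1) := by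
    intro i x
    simp only [Matrix.mulVec, dotProduct, Fintype.sum_prod_type, Fin.sum_univ_two, h10', h11']
    ring
  -- If this entry were zero, positivity of the minor would kill the whole row, contradicting `w (0,
  -- 0) ≠ 0`.
  have ha0 : σ (0, 0) (0, 0) ≠ 0 := fun h => by
    have h1 := (hσ.1.submatrix ![((0 : Fin 2), (0 : Fin 2)), (0, 1)]).det_nonneg
    rw [Matrix.det_fin_two] at h1
    simp only [Matrix.submatrix_apply, Matrix.cons_val_zero, Matrix.cons_val_one] at h1
    rw [h, hH (0, 1) (0, 0), Complex.mul_conj'] at h1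
    have h2 : (0 : ℂ) ≤ ((-‖σ (0, 0) (0, 1)‖ ^ 2 : ℝ) : ℂ) := by
      push_cast; simpa using h1
    have h3 := Complex.zero_le_real.1 h2
    have h4 : ‖σ (0, 0) (0, 1)‖ = 0 := by
      have := sq_nonneg ‖σ (0, 0) (0, 1)‖
      exact pow_eq_zero_iff two_ne_zero |>.1 (by linarith)
    obtain ⟨x, rfl⟩ := hw
    apply hw0
    rw [Matrix.mulVecLin_apply, hrow, h, norm_eq_zero.1 h4]
    ring
  refine exists_canonicalState_of_entries hσ (div_ne_zero hw1 hw0)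
    (fun x => h10 _ (hcol x)) (fun x => h11 _ (hcol x)) ha0 fun hdet => ha0 ?_
  -- With a vanishing minor, rows `(0, 0)` and `(0, 1)` would be dependent, yet they map a preimage
  -- of `|01⟩` to `0` and `1`; eliminating gives `σ (0, 0) (0, 0) = 0`.
  obtain ⟨x, hx⟩ := hket
  have e0 := congrFun hx (0, 0)
  have e1 := congrFun hx (0, 1)
  rw [Matrix.mulVecLin_apply, hrow] at e0 e1
  simp only [ket, Pi.single_eq_same] at e1
  rw [ket, Pi.single_eq_of_ne (by simp)] at e0
  linear_combination (-σ (0, 0) (0, 0)) * e1 + σ (0, 1) (0, 0) * e0 + x (0, 1) * hdet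

theorem IsState.conj {M : QubitPairMat} (hM : M ∈ Matrix.unitaryGroup _ ℂ)
    {ρ : QubitPairMat} (hρ : IsState ρ) : IsState (M * ρ * Mᴴ) := by
  refine ⟨hρ.1.mul_mul_conjTranspose_same M, ?_⟩
  rw [Matrix.trace_mul_comm, ← Matrix.mul_assoc, conjTranspose_mul_self_of_mem_unitary hM,
    Matrix.one_mul, hρ.2]

theorem exists_canonicalState_of_not_spanned {ρ : QubitPairMat} (hρ : IsState ρ)
    (hr : 2 ≤ ρ.rank) (hns : ¬ RangeSpannedByProducts ρ) :
    ∃ U ∈ Matrix.unitaryGroup (Fin 2) ℂ, ∃ V ∈ Matrix.unitaryGroup (Fin 2) ℂ,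
      ∃ α β γ l : ℝ, AdmissibleParams α β γ l ∧
        (U ⊗ₖ V) * ρ * (U ⊗ₖ V)ᴴ = canonicalState α β γ l := by
  obtain ⟨v, hv, hvp, -⟩ := rangeHasUniqueProduct_of_not_spanned hr hns
  obtain ⟨U, hU, V, hV, c, hc, hUV⟩ := exists_kronecker_mulVec_eq_ket hvp
  have hM := kronecker_mem_unitaryGroup hU hV
  have hket : ket 0 1 ∈ stateRange ((U ⊗ₖ V) * ρ * (U ⊗ₖ V)ᴴ) := by
    refine ((stateRange _).smul_mem_iff hc).1 ?_
    rw [← hUV, stateRange_conj hM]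
    exact Submodule.mem_map_of_mem (f := (U ⊗ₖ V).mulVecLin) hv
  obtain ⟨U', hU', V', hV', α, β, γ, l, hp, h⟩ := exists_canonicalState_of_ket_mem
    (hρ.conj hM) (mt (rangeSpannedByProducts_conj_iff hU hV).1 hns) hket
  refine ⟨U' * U, mul_mem hU' hU, V' * V, mul_mem hV' hV, α, β, γ, l, hp, ?_⟩
  rw [← h, Matrix.mul_kronecker_mul, Matrix.conjTranspose_mul]
  simp only [Matrix.mul_assoc]

theorem mainTheorem2 :
    (∀ ρ : QubitPairMat, IsState ρ → 2 ≤ ρ.rank →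
      (¬ RangeSpannedByProducts ρ ↔ (ρ.rank = 2 ∧ RangeHasUniqueProduct ρ)) ∧
      (¬ RangeSpannedByProducts ρ ↔
        ∃ U ∈ Matrix.unitaryGroup (Fin 2) ℂ, ∃ V ∈ Matrix.unitaryGroup (Fin 2) ℂ,
          ∃ α β γ l : ℝ, AdmissibleParams α β γ l ∧
            (U ⊗ₖ V) * ρ * (U ⊗ₖ V)ᴴ = canonicalState α β γ l) ∧
      (ρ.rank = 3 ∨ ρ.rank = 4 → RangeSpannedByProducts ρ)) ∧
    (∀ α β γ l : ℝ, AdmissibleParams α β γ l →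
      IsState (canonicalState α β γ l) ∧ (canonicalState α β γ l).rank = 2 ∧
        ¬ RangeSpannedByProducts (canonicalState α β γ l)) := by
  refine ⟨fun ρ hρ hr => ⟨⟨fun h => ⟨le_antisymm (rank_le_two_of_not_spanned h) hr,
    rangeHasUniqueProduct_of_not_spanned hr h⟩, fun h => h.2.not_spanned hr⟩,
    ⟨exists_canonicalState_of_not_spanned hρ hr, ?_⟩, fun h => ?_⟩,
    fun α β γ l h => ⟨isState_canonicalState h, rank_canonicalState h,
      not_spanned_canonicalState h⟩⟩
  · rintro ⟨U, hU, V, hV, α, β, γ, l, hp, h⟩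
    rw [← rangeSpannedByProducts_conj_iff hU hV, h]
    exact not_spanned_canonicalState hp
  · by_contra hns
    have := rank_le_two_of_not_spanned hns
    omega
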